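/- A \emph{plane graph} is a finite graph without loops (parallel edges are allowed; directed or undirected), drawn in the plane without edge crossings: vertices are distinct points, every edge is drawn as a simple arc between two distinct vertices, and an arc meets the vertices and the other arcs only in those of its endpoints that are vertices. Dangling edges, i.e. arcs with only one endpoint at a vertex and the other endpoint free, are also allowed. The degree of a vertex is the number of edges incident to it (entering or exiting, if the graph is directed; dangling edges are counted), and $G$ is \emph{$3$-regular} if every vertex has degree $3$. The \emph{outer face} of a plane graph is the unbounded connected component of the complement of the drawing; a vertex or an edge lies on the outer face if it is contained in the boundary of the outer face. The \emph{vertex-outerplanarity} $\mathrm{Out}_V(G)$ of a plane graph $G$ is the least number of rounds needed to obtain the empty graph, where in each round all the vertices on the outer face of the current plane graph are removed together with all their incident edges. The \emph{edge-outerplanarity} $\mathrm{Out}_E(G)$ of $G$ is the least integer $k \ge 0$ such that $k$ rounds leave a graph without edges, where in each round all the edges lying on the outer face of the current plane graph are deleted (and all vertices are kept). **Proposition.** If $G$ is a $3$-regular plane graph, directed or undirected, then $\mathrm{Out}_V(G)$ and $\mathrm{Out}_E(G)$ are well defined (both processes end), and $$\mathrm{Out}_V(G) \le \mathrm{Out}_E(G)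 \le 1 + \mathrm{Out}_V(G).$$ -/

import Mathlib

/-- A finite plane graph, with edges named by elements of `E`.
The plane is `ℂ`, and the vertices are points of the plane. Each edge `e ∈ edges` is drawn as a
(topological) arc `arc e`, i.e. an injective continuous image of the unit interval.
An end `arc e 0` or `arc e 1` of the arc is either a vertex or, for a dangling edge, a free end;
at least one of the two ends is a vertex.
There are no crossings: an arc can pass through a vertex only with one of its two ends, and
distinct arcs can meet only at vertices. There are no loops; parallel edges are allowed.
In the directed reading, `e` is directed from `arc e 0` to `arc e 1`; in the undirected reading
this direction is ignored. -/
structure PlaneGraph (E : Type*) where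
  /-- the vertices -/
  verts : Set ℂ
  /-- the edges -/
  edges : Set E
  /-- the drawing of the edges -/
  arc : E → C(unitInterval, ℂ)
  finite_verts : verts.Finite
  finite_edges : edges.Finite
  arc_injective : ∀ e ∈ edges, Function.Injective (arc e)
  end_mem : ∀ e ∈ edges, arc e 0 ∈ verts ∨ arc e 1 ∈ verts
  eq_end_of_mem : ∀ e ∈ edges, ∀ t, arc e t ∈ verts → t = 0 ∨ t = 1
  mem_of_meet : ∀ e ∈ edges, ∀ e' ∈ edges, e ≠ e' →
    ∀ s t, arc e s = arc e' t → arc e s ∈ verts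

namespace PlaneGraph

variable {E : Type*}

/-- The edge `e` is incident to the vertex `v`. -/
def Inc (G : PlaneGraph E) (e : E) (v : ℂ) : Prop :=
  e ∈ G.edges ∧ v ∈ G.verts ∧ (G.arc e 0 = v ∨ G.arc e 1 = v)

/-- The degree of a vertex: the number of edges incident to it (in the directed reading, entering
or exiting). -/
noncomputable def degree (G : PlaneGraph E) (v : ℂ) : ℕ :=
  {e | G.Inc e v}.ncard

/-- Every vertex has degree `d`. -/
def IsRegular (G : PlaneGraph E) (d : ℕ) : Prop :=
  ∀ v ∈ G.verts, G.degree v = d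

/-- The set of points of the plane covered by the drawing. -/
def support (G : PlaneGraph E) : Set ℂ :=
  G.verts ∪ ⋃ e ∈ G.edges, Set.range (G.arc e)

/-- The outer face: the unbounded connected component of the complement of the drawing. -/
def outerFace (G : PlaneGraph E) : Set ℂ :=
  {z | z ∈ G.supportᶜ ∧ ¬ Bornology.IsBounded (connectedComponentIn G.supportᶜ z)}

/-- The vertices lying on the outer face, i.e. on its boundary. -/
def outerVerts (G : PlaneGraph E) : Set ℂ :=
  {v | v ∈ G.verts ∧ v ∈ frontier G.outerFace}

/-- The edges lying on the outer face, i.e. contained in its boundary. -/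
def outerEdges (G : PlaneGraph E) : Set E :=
  {e | e ∈ G.edges ∧ Set.range (G.arc e) ⊆ frontier G.outerFace}

/-- Delete a set of edges, keeping all vertices. -/
def deleteEdges (G : PlaneGraph E) (K : Set E) : PlaneGraph E where
  verts := G.verts
  edges := G.edges \ K
  arc := G.arc
  finite_verts := G.finite_verts
  finite_edges := G.finite_edges.sdiff
  arc_injective e he := G.arc_injective e he.1
  end_mem e he := G.end_mem e he.1
  eq_end_of_mem e he := G.eq_end_of_mem e he.1
  mem_of_meet e he e' he' := G.mem_of_meet e he.1 e' he'.1

/-- Delete a set of vertices together with all edges incident to at least one of them. -/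
def deleteVerts (G : PlaneGraph E) (S : Set ℂ) : PlaneGraph E where
  verts := G.verts \ S
  edges := {e | e ∈ G.edges ∧ ∀ v ∈ S, ¬ G.Inc e v}
  arc := G.arc
  finite_verts := G.finite_verts.sdiff
  finite_edges := G.finite_edges.subset fun _ he => he.1
  arc_injective e he := G.arc_injective e he.1
  end_mem e he := by
    rcases G.end_mem e he.1 with h | h
    · exact Or.inl ⟨h, fun hS => he.2 _ hS ⟨he.1, h, Or.inl rfl⟩⟩
    · exact Or.inr ⟨h, fun hS => he.2 _ hS ⟨he.1, h, Or.inr rfl⟩⟩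
  eq_end_of_mem e he t ht := G.eq_end_of_mem e he.1 t ht.1
  mem_of_meet e he e' he' hne s t hst := by
    have h := G.mem_of_meet e he.1 e' he'.1 hne s t hst
    refine ⟨h, fun hS => he.2 _ hS ⟨he.1, h, ?_⟩⟩
    rcases G.eq_end_of_mem e he.1 s h with rfl | rfl
    · exact Or.inl rfl
    · exact Or.inr rfl

/-- One round of vertex peeling: remove all vertices on the outer face together with all their
incident edges. -/
def peelVerts (G : PlaneGraph E) : PlaneGraph E :=
  G.deleteVerts G.outerVerts

/-- One round of edge peeling: delete all edges lying on the outer face. -/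
def peelEdges (G : PlaneGraph E) : PlaneGraph E :=
  G.deleteEdges G.outerEdges

/-- The numbers of rounds of vertex peeling after which the graph is empty. -/
def vertexPeelings (G : PlaneGraph E) : Set ℕ :=
  {k | (peelVerts^[k] G).verts = ∅ ∧ (peelVerts^[k] G).edges = ∅}

/-- The numbers of rounds of edge peeling after which the graph has no edges. -/
def edgePeelings (G : PlaneGraph E) : Set ℕ :=
  {k | (peelEdges^[k] G).edges = ∅}

/-- The vertex-outerplanarity: the number of rounds of vertex peeling needed to obtain the empty
graph. -/
noncomputable def vertexOuterplanarity (G : PlaneGraph E) : ℕ :=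
  sInf G.vertexPeelings

/-- The edge-outerplanarity: the least number of rounds of edge peeling after which no edge is
left. -/
noncomputable def edgeOuterplanarity (G : PlaneGraph E) : ℕ :=
  sInf G.edgePeelings

end PlaneGraph

open Set Topology

/-! The two processes are compared by induction on the number `k` of rounds.

For the first inequality, what `k` rounds of vertex peeling leave is contained in what `k` rounds of
edge peeling leave, and a smaller drawing has a larger outer face. So the edges at a vertex survive
edge peeling for as long as the vertex survives vertex peeling (`mem_edges_peelEdges_iterate`). As
every vertex has an edge, no vertex outlives the edges.

For the second, once vertex peeling has removed `v`, edge peeling has left `v` on the outer face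
with at most one edge (`mem_frontier_and_subsingleton_inc`), and one extra round deletes all such
edges. Indeed, at a vertex on the boundary of a face either all edges lie on that boundary or at
least two do (`exists_inc_pair_of_not_subset`), so a vertex of degree at most 3 keeps at most one.
By induction the edge-peeled graph is the vertex-peeled one with isolated vertices and pendant edges
added, and these hide no vertex from the outer face (`outerVerts_subset_of_pendant`).

Arcs are merely continuous, so separation is handled by Eilenberg's criterion: points `a`, `b` off a
compact `K` lie in the same component of the complement iff `(z - a) / (z - b)` has a continuous
logarithm on `K`. Logarithms on closed sets with at most one common point glue (`LogOn.union`) and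
arcs always carry one (`logOn_arc`); hence attaching an arc at one point separates nothing. -/

/-! ### Continuous logarithms and separation of the plane -/

/-- `(z - a) / (z - b)` has a continuous logarithm on `K`. -/
def LogOn (K : Set ℂ) (a b : ℂ) : Prop :=
  ∃ g : ℂ → ℂ, ContinuousOn g K ∧ ∀ z ∈ K, Complex.exp (g z) = (z - a) / (z - b)

lemma exists_continuous_log {X : Type*} [TopologicalSpace X] [LocallyPathConnectedSpace X]
    [SimplyConnectedSpace X] {f : X → ℂ} (hf : Continuous f) (h0 : ∀ x, f x ≠ 0) :
    ∃ g : X → ℂ, Continuous g ∧ ∀ x, Complex.exp (g x) = f x := by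
  obtain ⟨x₀⟩ : Nonempty X := inferInstance
  obtain ⟨g, ⟨-, hg⟩, -⟩ := Complex.isCoveringMapOn_exp.existsUnique_continuousMap_lifts
    (⟨f, hf⟩ : C(X, ℂ)) (a₀ := x₀) (e₀ := Complex.log (f x₀)) (Complex.exp_log (h0 x₀))
    (fun x => h0 x)
  exact ⟨g, g.continuous, fun x => congrFun hg x⟩

/-- By uniqueness of lifts through `exp`, `g` gains `2πi` along one turn of the circle, although it
returns to the same point. -/
lemma not_exists_log_circle (a : ℂ) {R : ℝ} (hR : 0 < R) {g : ℂ → ℂ} (hg : Continuous g)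
    (h : ∀ z, ‖z - a‖ = R → Complex.exp (g z) = z - a) : False := by
  let p : ℝ → ℂ := fun θ => a + R * Complex.exp (θ * Complex.I)
  have hp : ∀ θ, Complex.exp (g (p θ)) = R * Complex.exp (θ * Complex.I) := by
    intro θ
    rw [h (p θ) (by simp [p, Complex.norm_exp_ofReal_mul_I, abs_of_pos hR])]
    simp [p]
  have hpc : Continuous p := by fun_prop
  have key : (fun θ => g (p θ)) = fun θ : ℝ => g (p 0) + θ * Complex.I := by
    refine Complex.isCoveringMap_exp.eq_of_comp_eq (hg.comp hpc) (by fun_prop) ?_ 0 (by simp)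
    funext θ
    refine Subtype.ext ?_
    simp only [Function.comp]
    rw [hp, Complex.exp_add, hp]
    simp
  have h1 := congrFun key (2 * Real.pi)
  have h2 : p (2 * Real.pi) = p 0 := by simp [p, Complex.exp_two_pi_mul_I]
  simp only [h2] at h1
  have h3 : ((2 * Real.pi : ℝ) : ℂ) * Complex.I = 0 := by
    linear_combination -h1
  simp [Real.pi_ne_zero] at h3

lemma not_logOn_of_isBounded {K D : Set ℂ} (hK : IsClosed K)
    (hDb : Bornology.IsBounded D) (hDK : frontier D ⊆ K) {a b : ℂ} (ha : a ∈ D) (hb : b ∉ D)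
    (hbK : b ∉ K) : ¬ LogOn K a b := by
  classical
  rintro ⟨g, hg, hgK⟩
  obtain ⟨G, hG⟩ := ContinuousMap.exists_restrict_eq hK
    (⟨K.domRestrict g, continuousOn_iff_continuous_domRestrict.1 hg⟩ : C(K, ℂ))
  have hGK : ∀ z ∈ K, G z = g z := fun z hz => congrArg (fun f : C(K, ℂ) => f ⟨z, hz⟩) hG
  -- The two formulas agree on the frontier of `D`, so `h` is a nonvanishing function on the plane
  -- and has a logarithm; but on a large circle it is `z - a`.
  let h : ℂ → ℂ := D.piecewise (fun z => Complex.exp (G z) * (z - b)) (fun z => z - a)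
  have hc : Continuous h := by
    refine continuous_piecewise ?_ (by fun_prop) (by fun_prop)
    intro z hz
    have hzK := hDK hz
    have : z - b ≠ 0 := sub_ne_zero.2 fun h => hbK (h ▸ hzK)
    simp only [hGK z hzK, hgK z hzK]
    field_simp
  have h0 : ∀ z, h z ≠ 0 := by
    intro z
    by_cases hz : z ∈ D
    · simp only [h, piecewise_eq_of_mem _ _ _ hz]
      exact mul_ne_zero (Complex.exp_ne_zero _) (sub_ne_zero.2 fun h => hb (h ▸ hz))
    · simp only [h, piecewise_eq_of_notMem _ _ _ hz]
      exact sub_ne_zero.2 fun h => hz (h ▸ ha)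
  obtain ⟨L, hL, hLh⟩ := exists_continuous_log hc h0
  obtain ⟨R, hR⟩ := hDb.subset_ball a
  have hRpos : 0 < R := by simpa using (Metric.mem_ball.1 (hR ha))
  refine not_exists_log_circle a hRpos hL fun z hz => ?_
  have hzD : z ∉ D := fun hzD => by
    have := hR hzD
    rw [Metric.mem_ball, dist_eq_norm, hz] at this
    exact lt_irrefl _ this
  rw [hLh]
  simp only [h, piecewise_eq_of_notMem _ _ _ hzD]

lemma LogOn.mono {K K' : Set ℂ} {a b : ℂ} (h : LogOn K a b) (hK : K' ⊆ K) : LogOn K' a b := by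
  obtain ⟨g, hg, h⟩ := h
  exact ⟨g, hg.mono hK, fun z hz => h z (hK hz)⟩

lemma LogOn.symm {K : Set ℂ} {a b : ℂ} (h : LogOn K a b) : LogOn K b a := by
  obtain ⟨g, hg, h⟩ := h
  refine ⟨fun z => - g z, hg.neg, fun z hz => ?_⟩
  rw [Complex.exp_neg, h z hz, inv_div]

lemma LogOn.trans {K : Set ℂ} {a b c : ℂ} (hb : b ∉ K) (h : LogOn K a b) (h' : LogOn K b c) :
    LogOn K a c := by
  obtain ⟨g, hg, h⟩ := h
  obtain ⟨g', hg', h'⟩ := h'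
  refine ⟨fun z => g z + g' z, hg.add hg', fun z hz => ?_⟩
  have : z - b ≠ 0 := sub_ne_zero.2 fun h => hb (h ▸ hz)
  rw [Complex.exp_add, h z hz, h' z hz]
  field_simp

/-- The relation `LogOn K` is transitive off `K`, so it suffices to treat nearby points; for these
the quotient is close to 1 and the principal logarithm works. -/
lemma logOn_of_isPreconnected {K T : Set ℂ} (hK : IsClosed K) (hT : IsPreconnected T)
    (hTK : T ⊆ Kᶜ) {a b : ℂ} (ha : a ∈ T) (hb : b ∈ T) : LogOn K a b := by
  refine hT.induction₂' (LogOn K) (fun x hx => ?_)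
    (fun x y z _ hy _ hxy hyz => hxy.trans (hTK hy) hyz) ha hb
  obtain ⟨ε, hε, hball⟩ := Metric.isOpen_iff.1 hK.isOpen_compl x (hTK hx)
  filter_upwards [mem_nhdsWithin_of_mem_nhds (Metric.ball_mem_nhds x hε)] with y hy
  suffices h : LogOn K y x from ⟨h.symm, h⟩
  have hne : ∀ z ∈ K, z - x ≠ 0 := fun z hz h => hTK hx (sub_eq_zero.1 h ▸ hz)
  have hslit : ∀ z ∈ K, (z - y) / (z - x) ∈ Complex.slitPlane := by
    intro z hz
    have h1 : (z - y) / (z - x) = 1 + (x - y) / (z - x) := by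
      have := hne z hz
      field_simp
      ring
    rw [h1]
    refine Complex.mem_slitPlane_of_norm_lt_one ?_
    have hzx : ε ≤ ‖z - x‖ := by
      by_contra hlt
      exact hball (by rw [Metric.mem_ball, dist_eq_norm]; exact not_le.1 hlt) hz
    rw [norm_div, div_lt_one (lt_of_lt_of_le hε hzx)]
    refine lt_of_lt_of_le ?_ hzx
    rw [← dist_eq_norm, dist_comm]
    exact hy
  refine ⟨fun z => Complex.log ((z - y) / (z - x)), ?_, fun z hz =>
    Complex.exp_log (Complex.slitPlane_ne_zero (hslit z hz))⟩
  exact ContinuousOn.clog (ContinuousOn.div (by fun_prop) (by fun_prop) hne) hslit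

/-- At the only possible common point the two logarithms differ by a period of `exp`; shifting one
of them by it makes them agree. -/
lemma LogOn.union {K L : Set ℂ} (hK : IsClosed K) (hL : IsClosed L) (hKL : (K ∩ L).Subsingleton)
    {a b : ℂ} (h : LogOn K a b) (h' : LogOn L a b) : LogOn (K ∪ L) a b := by
  classical
  obtain ⟨g, hg, hgK⟩ := h
  obtain ⟨g', hg', hgL⟩ := h'
  obtain ⟨c, hc, hcKL⟩ : ∃ c, Complex.exp c = 1 ∧ ∀ z ∈ K ∩ L, g z = g' z + c := by
    rcases (K ∩ L).eq_empty_or_nonempty with h | ⟨w, hw⟩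
    · exact ⟨0, by simp, by simp [h]⟩
    · refine ⟨g w - g' w, ?_, fun z hz => ?_⟩
      · rw [Complex.exp_sub, hgK w hw.1, ← hgL w hw.2]
        exact div_self (Complex.exp_ne_zero _)
      · rw [hKL hz hw]
        ring
  have h1 : EqOn (K.piecewise g fun z => g' z + c) g K := piecewise_eqOn _ _ _
  have h2 : EqOn (K.piecewise g fun z => g' z + c) (fun z => g' z + c) L := by
    intro z hz
    by_cases hzK : z ∈ K
    · rw [piecewise_eq_of_mem _ _ _ hzK]
      exact hcKL z ⟨hzK, hz⟩
    · rw [piecewise_eq_of_notMem _ _ _ hzK]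
  refine ⟨K.piecewise g fun z => g' z + c, ?_, ?_⟩
  · exact (hg.congr h1).union_of_isClosed ((hg'.add continuousOn_const).congr h2) hK hL
  · rintro z (hz | hz)
    · rw [h1 hz, hgK z hz]
    · rw [h2 hz, Complex.exp_add, hc, hgL z hz, mul_one]

lemma logOn_singleton {w a b : ℂ} (ha : a ≠ w) (hb : b ≠ w) : LogOn {w} a b := by
  refine ⟨fun _ => Complex.log ((w - a) / (w - b)), continuousOn_const, ?_⟩
  rintro z rfl
  exact Complex.exp_log (div_ne_zero (sub_ne_zero.2 ha.symm) (sub_ne_zero.2 hb.symm))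

lemma logOn_arc (γ : C(unitInterval, ℂ)) (hγ : Function.Injective γ) {s t : unitInterval}
    (hst : s ≤ t) {a b : ℂ} (ha : a ∉ γ '' Icc s t) (hb : b ∉ γ '' Icc s t) :
    LogOn (γ '' Icc s t) a b := by
  -- Clamping the parameter to `[s, t]` keeps the quotient defined and nonzero on all of `ℝ`, where
  -- a logarithm exists.
  let r : unitInterval → unitInterval := fun x => max s (min t x)
  have hr : Continuous r := by fun_prop
  have hrm : ∀ x, r x ∈ Icc s t := fun x => ⟨le_max_left _ _, max_le hst (min_le_left _ _)⟩
  have hra : ∀ x, γ (r x) - a ≠ 0 := fun x h => ha ⟨r x, hrm x, sub_eq_zero.1 h⟩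
  have hrb : ∀ x, γ (r x) - b ≠ 0 := fun x h => hb ⟨r x, hrm x, sub_eq_zero.1 h⟩
  obtain ⟨g, hg, hgf⟩ := exists_continuous_log (X := ℝ)
    (f := fun x => (γ (r (projIcc 0 1 zero_le_one x)) - a) /
      (γ (r (projIcc 0 1 zero_le_one x)) - b))
    (by
      have : Continuous fun x : ℝ => γ (r (projIcc 0 1 zero_le_one x)) :=
        γ.continuous.comp (hr.comp continuous_projIcc)
      exact (this.sub continuous_const).div (this.sub continuous_const) fun x => hrb _)
    (fun x => div_ne_zero (hra _) (hrb _))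
  have he : IsClosedEmbedding γ := γ.continuous.isClosedEmbedding hγ
  obtain ⟨G, hG⟩ := ContinuousMap.exists_extension he
    (⟨fun x : unitInterval => g x, hg.comp continuous_subtype_val⟩ : C(unitInterval, ℂ))
  refine ⟨G, G.continuous.continuousOn, ?_⟩
  rintro z ⟨x, hx, rfl⟩
  have h1 : G (γ x) = g x := congrArg (fun f : C(unitInterval, ℂ) => f x) hG
  have h2 : r x = x := by simp [r, hx.1, hx.2]
  have h3 := hgf x
  rw [projIcc_val, h2] at h3
  rw [h1, h3]

/-! ### Faces -/

lemma isPreconnected_compl_closedBall (R : ℝ) :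
    IsPreconnected (Metric.closedBall (0 : ℂ) R)ᶜ := by
  rcases lt_or_ge R 0 with hR | hR
  · rw [Metric.closedBall_eq_empty.2 hR, compl_empty]
    exact isPreconnected_univ
  have : (Metric.closedBall (0 : ℂ) R)ᶜ =
      (fun p : ℝ × ℝ => (p.1 : ℂ) * Complex.exp (p.2 * Complex.I)) '' (Ioi R ×ˢ univ) := by
    ext z
    simp only [mem_compl_iff, Metric.mem_closedBall, dist_zero_right, not_le, mem_image]
    constructor
    · intro hz
      exact ⟨(‖z‖, z.arg), ⟨hz, mem_univ _⟩, Complex.norm_mul_exp_arg_mul_I z⟩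
    · rintro ⟨⟨r, θ⟩, ⟨hr, -⟩, rfl⟩
      have hr' : R < r := hr
      rw [norm_mul, Complex.norm_exp_ofReal_mul_I, mul_one, Complex.norm_real, Real.norm_eq_abs,
        abs_of_pos (hR.trans_lt hr')]
      exact hr'
  rw [this]
  exact (isPreconnected_Ioi.prod isPreconnected_univ).image _ (by fun_prop)

/-- `F` is a union of connected components of the complement of `S`, and connected. -/
structure IsFace (S F : Set ℂ) : Prop where
  isOpen : IsOpen F
  isPreconnected : IsPreconnected F
  subset_compl : F ⊆ Sᶜ
  frontier_subset : frontier F ⊆ S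

lemma IsFace.subset_of_isPreconnected {S F T : Set ℂ} (hF : IsFace S F) (hT : IsPreconnected T)
    (hTS : T ⊆ Sᶜ) (hTF : (T ∩ F).Nonempty) : T ⊆ F := by
  refine hT.subset_of_closure_inter_subset hF.isOpen hTF ?_
  rintro z ⟨hz, hzT⟩
  by_contra hzF
  exact hTS hzT (hF.frontier_subset ⟨hz, fun h => hzF (interior_subset h)⟩)

/-- Parts of a drawing away from the boundary of a face can be erased without changing that face;
the arguments by contradiction below rest on this. -/
lemma IsFace.mono {S S' F : Set ℂ} (hF : IsFace S F) (hS : S' ⊆ S) (h : frontier F ⊆ S') :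
    IsFace S' F :=
  ⟨hF.isOpen, hF.isPreconnected, hF.subset_compl.trans (compl_subset_compl.2 hS), h⟩

lemma isFace_connectedComponentIn {S : Set ℂ} (hS : IsClosed S) (z : ℂ) :
    IsFace S (connectedComponentIn Sᶜ z) := by
  refine ⟨hS.isOpen_compl.connectedComponentIn, isPreconnected_connectedComponentIn,
    connectedComponentIn_subset _ _, ?_⟩
  intro w hw
  by_contra hwS
  have hwo : IsOpen (connectedComponentIn Sᶜ w) := hS.isOpen_compl.connectedComponentIn
  obtain ⟨u, hu, hu'⟩ := mem_closure_iff.1 hw.1 _ hwo (mem_connectedComponentIn hwS)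
  have h1 := connectedComponentIn_eq hu
  have h2 := connectedComponentIn_eq hu'
  apply hw.2
  rw [hS.isOpen_compl.connectedComponentIn.interior_eq, h2, ← h1]
  exact mem_connectedComponentIn hwS

lemma compl_closedBall_subset_connectedComponentIn {K : Set ℂ} {R : ℝ}
    (hR : K ⊆ Metric.closedBall 0 R) {z : ℂ}
    (hz : ¬ Bornology.IsBounded (connectedComponentIn Kᶜ z)) :
    (Metric.closedBall (0 : ℂ) R)ᶜ ⊆ connectedComponentIn Kᶜ z := by
  obtain ⟨w, hw, hwR⟩ : ∃ w ∈ connectedComponentIn Kᶜ z, w ∉ Metric.closedBall (0 : ℂ) R := by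
    by_contra! h
    exact hz (Metric.isBounded_closedBall.subset h)
  rw [connectedComponentIn_eq hw]
  exact (isPreconnected_compl_closedBall R).subset_connectedComponentIn hwR
    (compl_subset_compl.2 hR)

lemma not_isBounded_compl_closedBall (R : ℝ) :
    ¬ Bornology.IsBounded (Metric.closedBall (0 : ℂ) R)ᶜ := fun h =>
  NormedSpace.unbounded_univ ℝ ℂ (by
    simpa using h.union (Metric.isBounded_closedBall (x := (0 : ℂ)) (r := R)))

/-- If the components differed, one would be bounded, as two unbounded ones share the points far
away; `not_logOn_of_isBounded` excludes this. -/
lemma LogOn.mem_connectedComponentIn {K : Set ℂ} (hK : IsCompact K) {a b : ℂ} (ha : a ∉ K)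
    (hb : b ∉ K) (h : LogOn K a b) : b ∈ connectedComponentIn Kᶜ a := by
  by_contra hab
  have hba : a ∉ connectedComponentIn Kᶜ b := fun h' =>
    hab (connectedComponentIn_eq h' ▸ _root_.mem_connectedComponentIn hb)
  have hKo := hK.isClosed.isOpen_compl
  by_cases h1 : Bornology.IsBounded (connectedComponentIn Kᶜ a)
  · exact not_logOn_of_isBounded hK.isClosed h1
      (isFace_connectedComponentIn hK.isClosed a).frontier_subset
      (_root_.mem_connectedComponentIn ha) hab hb h
  by_cases h2 : Bornology.IsBounded (connectedComponentIn Kᶜ b)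
  · exact not_logOn_of_isBounded hK.isClosed h2
      (isFace_connectedComponentIn hK.isClosed b).frontier_subset
      (_root_.mem_connectedComponentIn hb) hba ha h.symm
  obtain ⟨R, hR⟩ := hK.isBounded.subset_closedBall 0
  obtain ⟨w, hw⟩ : (Metric.closedBall (0 : ℂ) R)ᶜ.Nonempty := by
    by_contra h0
    rw [not_nonempty_iff_eq_empty] at h0
    exact not_isBounded_compl_closedBall R (h0 ▸ Bornology.isBounded_empty)
  have hwa := compl_closedBall_subset_connectedComponentIn hR h1 hw
  have hwb := compl_closedBall_subset_connectedComponentIn hR h2 hw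
  apply hab
  rw [connectedComponentIn_eq hwa, ← connectedComponentIn_eq hwb]
  exact _root_.mem_connectedComponentIn hb

/-- If `A` is attached to `R` at no more than one point and `T ⊆ A \ R` is a connected set meeting
the closure of the face `F`, then `F` surrounds `A` near `T`. -/
lemma IsFace.exists_isOpen_diff_subset {R A T F : Set ℂ} (hF : IsFace (R ∪ A) F)
    (hR : IsCompact R) (hA : IsCompact A) (hRA : (R ∩ A).Subsingleton)
    (hlog : ∀ a b, a ∉ A → b ∉ A → LogOn A a b) (hT : IsPreconnected T) (hTR : Disjoint T R)
    (hTF : (T ∩ closure F).Nonempty) : ∃ U, IsOpen U ∧ T ⊆ U ∧ U \ A ⊆ F := by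
  obtain ⟨x, hxT, hxF⟩ := hTF
  have hxR : x ∉ R := fun h => hTR.le_bot ⟨hxT, h⟩
  have hU : IsOpen (connectedComponentIn Rᶜ x) := hR.isClosed.isOpen_compl.connectedComponentIn
  have hUR := connectedComponentIn_subset Rᶜ x
  refine ⟨connectedComponentIn Rᶜ x, hU, hT.subset_connectedComponentIn hxT
    fun y hy h => hTR.le_bot ⟨hy, h⟩, ?_⟩
  refine hF.subset_of_isPreconnected ?_ ?_ ?_
  -- Two points of the component of `Rᶜ` that avoid `A` have a logarithm on `R` and one on `A`;
  -- these glue, so `A` does not separate the points.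
  · refine isPreconnected_of_forall_pair fun a ha b hb => ?_
    have haS : a ∉ R ∪ A := fun h => h.elim (hUR ha.1) ha.2
    have hbS : b ∉ R ∪ A := fun h => h.elim (hUR hb.1) hb.2
    have h1 : LogOn R a b :=
      logOn_of_isPreconnected hR.isClosed isPreconnected_connectedComponentIn hUR ha.1 hb.1
    have h2 := (h1.union hR.isClosed hA.isClosed hRA (hlog a b ha.2 hb.2)).mem_connectedComponentIn
      (hR.union hA) haS hbS
    refine ⟨connectedComponentIn (R ∪ A)ᶜ a, ?_, mem_connectedComponentIn haS, h2,
      isPreconnected_connectedComponentIn⟩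
    intro z hz
    refine ⟨?_, fun h => connectedComponentIn_subset _ _ hz (Or.inr h)⟩
    rw [connectedComponentIn_eq ha.1]
    exact connectedComponentIn_mono _ (compl_subset_compl.2 subset_union_left) hz
  · intro z hz h
    exact h.elim (hUR hz.1) hz.2
  · obtain ⟨y, hyU, hyF⟩ := mem_closure_iff.1 hxF _ hU (mem_connectedComponentIn hxR)
    exact ⟨y, ⟨hyU, fun h => hF.subset_compl hyF (Or.inr h)⟩, hyF⟩

/-! ### Arcs -/

lemma not_injective_of_continuous_real {f : ℂ → ℝ} (hf : Continuous f) :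
    ¬ Function.Injective f := by
  intro hinj
  obtain ⟨p, q, hpq⟩ : ∃ p q, f p < f q := by
    rcases lt_or_gt_of_ne (hinj.ne (zero_ne_one : (0 : ℂ) ≠ 1)) with h | h
    exacts [⟨_, _, h⟩, ⟨_, _, h⟩]
  obtain ⟨m, hm⟩ := exists_between hpq
  obtain ⟨y, -, hy⟩ := isPreconnected_univ.intermediate_value (mem_univ p) (mem_univ q)
    hf.continuousOn ⟨hm.1.le, hm.2.le⟩
  have hp : p ∈ ({y}ᶜ : Set ℂ) := by
    rintro rfl
    exact hm.1.ne hy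
  have hq : q ∈ ({y}ᶜ : Set ℂ) := by
    rintro rfl
    exact hm.2.ne' hy
  obtain ⟨z, hz, hzm⟩ := (isConnected_compl_singleton_of_one_lt_rank (by simp)
    y).isPreconnected.intermediate_value hp hq hf.continuousOn ⟨hm.1.le, hm.2.le⟩
  exact hz (hinj (hzm.trans hy.symm))

/-- On a disc inside the arc the inverse of `γ` would be a continuous injection into `ℝ`. -/
lemma interior_range_arc (γ : C(unitInterval, ℂ)) (hγ : Function.Injective γ) :
    interior (range γ) = ∅ := by
  by_contra hne
  obtain ⟨x, hx⟩ := nonempty_iff_ne_empty.2 hne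
  obtain ⟨r, hr, hball⟩ := Metric.isOpen_iff.1 isOpen_interior x hx
  obtain ⟨G, hG⟩ := ContinuousMap.exists_extension (γ.continuous.isClosedEmbedding hγ)
    (⟨Subtype.val, continuous_subtype_val⟩ : C(unitInterval, ℝ))
  have hGγ : ∀ u, G (γ u) = u := fun u => congrArg (fun f : C(unitInterval, ℝ) => f u) hG
  let φ := OpenPartialHomeomorph.univBall x r
  have hφ : Continuous φ := OpenPartialHomeomorph.continuous_univBall x r
  have hφr : ∀ z, φ z ∈ range γ := by
    intro z
    refine interior_subset (hball ?_)
    rw [← OpenPartialHomeomorph.univBall_target x hr]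
    exact φ.map_source (by simp [φ])
  refine not_injective_of_continuous_real (G.continuous.comp hφ) fun z w hzw => ?_
  obtain ⟨u, hu⟩ := hφr z
  obtain ⟨u', hu'⟩ := hφr w
  simp only [Function.comp, ← hu, ← hu', hGγ] at hzw
  have : φ z = φ w := by rw [← hu, ← hu', Subtype.ext hzw]
  exact φ.injOn (by simp [φ]) (by simp [φ]) this

lemma unitInterval.exists_mem_ne {V : Set unitInterval} {x : unitInterval} (hV : V ∈ 𝓝 x) :
    ∃ u ∈ V, u ≠ 0 ∧ u ≠ 1 := by
  have hd : Dense ((univ : Set unitInterval) \ {0, 1}) := dense_univ.sdiff_finite (toFinite _)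
  obtain ⟨u, hu, hu'⟩ := mem_closure_iff_nhds.1 (hd x) V hV
  refine ⟨u, hu, ?_⟩
  simpa using hu'

/-- One half of `IsFace.range_arc_subset_frontier`: propagation towards the end of the arc. -/
lemma IsFace.arc_mem_frontier_of_lt {R F : Set ℂ} {γ : C(unitInterval, ℂ)}
    (hF : IsFace (R ∪ range γ) F) (hR : IsCompact R) (hγ : Function.Injective γ)
    (hRγ : ∀ u, γ u ∈ R → u = 0 ∨ u = 1) {s t : unitInterval} (hst : s < t) (hsR : γ s ∉ R)
    (hs : γ s ∈ frontier F) : γ t ∈ frontier F := by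
  by_contra ht
  have hopen : IsOpen (γ ⁻¹' (frontier F)ᶜ) := isClosed_frontier.isOpen_compl.preimage γ.continuous
  obtain ⟨l, hl, hlt⟩ := exists_Ioc_subset_of_mem_nhds (hopen.mem_nhds ht) ⟨s, hst⟩
  obtain ⟨t', ht', ht't⟩ := exists_between (max_lt hl hst)
  obtain ⟨hlt', hst'⟩ := max_lt_iff.1 ht'
  have hF' : IsFace ((R ∪ γ '' Icc t 1) ∪ γ '' Icc 0 t') F := by
    refine hF.mono ?_ fun x hx => ?_
    · rintro x ((hx | ⟨u, -, rfl⟩) | ⟨u, -, rfl⟩)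
      exacts [Or.inl hx, Or.inr ⟨u, rfl⟩, Or.inr ⟨u, rfl⟩]
    · rcases hF.frontier_subset hx with h | ⟨u, rfl⟩
      · exact Or.inl (Or.inl h)
      rcases le_or_gt u t' with h | h
      · exact Or.inr ⟨u, ⟨unitInterval.nonneg', h⟩, rfl⟩
      rcases le_or_gt t u with h' | h'
      · exact Or.inl (Or.inr ⟨u, ⟨h', unitInterval.le_one'⟩, rfl⟩)
      · exact absurd hx (hlt ⟨hlt'.trans h, h'.le⟩)
  have hdisj : ∀ u, u ≤ t' → γ u ∈ R ∪ γ '' Icc t 1 → u = 0 := by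
    rintro u hu (h | ⟨u', hu', h⟩)
    · refine (hRγ u h).resolve_right ?_
      rintro rfl
      exact not_lt_of_ge unitInterval.le_one' (hu.trans_lt ht't)
    · rw [hγ h] at hu'
      exact absurd (hu'.1.trans hu) (not_le_of_gt ht't)
  have hsub : ((R ∪ γ '' Icc t 1) ∩ γ '' Icc 0 t').Subsingleton := by
    rintro x ⟨hxR, u, hu, rfl⟩ y ⟨hyR, u', hu', rfl⟩
    rw [hdisj u hu.2 hxR, hdisj u' hu'.2 hyR]
  have hdisj' : Disjoint (γ '' Icc s t') (R ∪ γ '' Icc t 1) := by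
    rw [disjoint_left]
    rintro x ⟨u, hu, rfl⟩ hxR
    have h0 := hdisj u hu.2 hxR
    have hs0 : s = 0 := le_antisymm (h0 ▸ hu.1) unitInterval.nonneg'
    rcases hxR with h | ⟨u', hu', h⟩
    · rw [h0, ← hs0] at h
      exact hsR h
    · rw [hγ h] at hu'
      exact absurd (hu'.1.trans hu.2) (not_le_of_gt ht't)
  obtain ⟨U, hU, hTU, hUF⟩ := hF'.exists_isOpen_diff_subset (T := γ '' Icc s t')
    (hR.union (isCompact_Icc.image γ.continuous)) (isCompact_Icc.image γ.continuous) hsub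
    (fun a b ha hb => logOn_arc γ hγ unitInterval.nonneg' ha hb)
    (isPreconnected_Icc.image _ γ.continuous.continuousOn) hdisj'
    ⟨γ s, ⟨s, ⟨le_rfl, hst'.le⟩, rfl⟩, frontier_subset_closure hs⟩
  have hU' : γ ⁻¹' U ∈ 𝓝 t' :=
    (hU.preimage γ.continuous).mem_nhds (hTU ⟨t', ⟨hst'.le, le_rfl⟩, rfl⟩)
  obtain ⟨r, hr, hrU⟩ := exists_Ico_subset_of_mem_nhds hU' ⟨t, ht't⟩
  obtain ⟨u, hu, hur⟩ := exists_between hr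
  refine hF.subset_compl (hUF ⟨hrU ⟨hu.le, hur⟩, ?_⟩) (Or.inr ⟨u, rfl⟩)
  rintro ⟨u', hu', h⟩
  rw [hγ h] at hu'
  exact absurd hu'.2 (not_le_of_gt hu)

lemma IsFace.range_arc_subset_frontier {R F : Set ℂ} {γ : C(unitInterval, ℂ)}
    (hF : IsFace (R ∪ range γ) F) (hR : IsCompact R) (hγ : Function.Injective γ)
    (hRγ : ∀ u, γ u ∈ R → u = 0 ∨ u = 1) {s : unitInterval} (hsR : γ s ∉ R)
    (hs : γ s ∈ frontier F) : range γ ⊆ frontier F := by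
  rintro _ ⟨t, rfl⟩
  rcases lt_trichotomy s t with h | rfl | h
  · exact hF.arc_mem_frontier_of_lt hR hγ hRγ h hsR hs
  · exact hs
  · let γ' : C(unitInterval, ℂ) := γ.comp ⟨unitInterval.symm, unitInterval.continuous_symm⟩
    have hγ' : ∀ u, γ' (unitInterval.symm u) = γ u := fun u => by simp [γ']
    have hr : range γ' = range γ := by
      simpa [γ'] using unitInterval.symm_bijective.surjective.range_comp γ
    have := IsFace.arc_mem_frontier_of_lt (γ := γ') (F := F) (hr ▸ hF) hR
      (hγ.comp unitInterval.symm_bijective.injective) ?_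
      (s := unitInterval.symm s) (t := unitInterval.symm t) (unitInterval.strictAnti_symm h)
      (by rwa [hγ']) (by rwa [hγ'])
    · rwa [hγ'] at this
    · intro u hu
      rcases hRγ _ hu with h | h
      · exact Or.inr (by simpa using congrArg unitInterval.symm h)
      · exact Or.inl (by simpa using congrArg unitInterval.symm h)

lemma LogOn.biUnion {ι : Type*} {K : Set ℂ} {T : Set ι} {A : ι → Set ℂ} {a b : ℂ}
    (hT : T.Finite) (hK : IsClosed K) (hA : ∀ i ∈ T, IsClosed (A i)) (h : LogOn K a b)
    (h' : ∀ i ∈ T, LogOn (A i) a b)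
    (hs : ∀ i ∈ T, ((K ∪ ⋃ j ∈ T \ {i}, A j) ∩ A i).Subsingleton) :
    LogOn (K ∪ ⋃ i ∈ T, A i) a b := by
  suffices ∀ T' ⊆ T, LogOn (K ∪ ⋃ i ∈ T', A i) a b from this T subset_rfl
  intro T' hT'
  induction T', hT.subset hT' using Set.Finite.induction_on with
  | empty => simpa using h
  | @insert i T' hi hfin ih =>
    have hiT : i ∈ T := hT' (mem_insert _ _)
    have hT'T : T' ⊆ T := (subset_insert _ _).trans hT'
    rw [biUnion_insert, union_comm (A i), ← union_assoc]
    refine (ih hT'T).union (hK.union (hfin.isClosed_biUnion fun j hj => hA j (hT'T hj)))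
      (hA i hiT) ((hs i hiT).anti (inter_subset_inter_left _ (union_subset_union_right _ ?_)))
      (h' i hiT)
    exact biUnion_subset_biUnion_left fun j hj => ⟨hT'T hj, fun h => hi (h ▸ hj)⟩

/-! ### Plane graphs: the outer face and the edges around a vertex -/

namespace PlaneGraph

variable {E : Type*}

lemma isCompact_range_arc (G : PlaneGraph E) (e : E) : IsCompact (range (G.arc e)) :=
  isCompact_range (G.arc e).continuous

lemma isCompact_verts_union (G : PlaneGraph E) {V : Set ℂ} {B : Set E} (hV : V ⊆ G.verts)
    (hB : B ⊆ G.edges) : IsCompact (V ∪ ⋃ e ∈ B, range (G.arc e)) :=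
  (G.finite_verts.subset hV).isCompact.union
    ((G.finite_edges.subset hB).isCompact_biUnion fun e _ => G.isCompact_range_arc e)

lemma isCompact_support (G : PlaneGraph E) : IsCompact G.support :=
  G.isCompact_verts_union subset_rfl subset_rfl

lemma verts_subset_support (G : PlaneGraph E) : G.verts ⊆ G.support := subset_union_left

lemma range_arc_subset_support {G : PlaneGraph E} {e : E} (he : e ∈ G.edges) :
    range (G.arc e) ⊆ G.support :=
  (subset_biUnion_of_mem (u := fun e => range (G.arc e)) he).trans subset_union_right

lemma interior_support (G : PlaneGraph E) : interior G.support = ∅ := by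
  have hfin : ∀ V : Set ℂ, V.Finite → interior V = ∅ := fun V hV => by
    rw [interior_eq_empty_iff_dense_compl]
    exact hV.countable.dense_compl ℝ
  suffices ∀ B ⊆ G.edges, interior (G.verts ∪ ⋃ e ∈ B, range (G.arc e)) = ∅ from
    this _ subset_rfl
  intro B hB
  induction B, G.finite_edges.subset hB using Set.Finite.induction_on with
  | empty => simpa using hfin _ G.finite_verts
  | @insert e B he hfin ih =>
    have hB' := (subset_insert _ _).trans hB
    rw [biUnion_insert, union_comm (range _), ← union_assoc,
      interior_union_isClosed_of_interior_empty
        (G.isCompact_verts_union subset_rfl hB').isClosed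
        (interior_range_arc _ (G.arc_injective e (hB (mem_insert _ _))))]
    exact ih hB'

/-- The outside of a large disc is connected, so there is exactly one unbounded component. -/
lemma exists_outerFace_eq (G : PlaneGraph E) : ∃ R : ℝ, ∀ w ∉ Metric.closedBall (0 : ℂ) R,
    w ∈ G.outerFace ∧ G.outerFace = connectedComponentIn G.supportᶜ w := by
  obtain ⟨R, hR⟩ := G.isCompact_support.isBounded.subset_closedBall 0
  refine ⟨R, fun w hw => ?_⟩
  have hwS : w ∈ G.supportᶜ := fun h => hw (hR h)
  have hwb : ¬ Bornology.IsBounded (connectedComponentIn G.supportᶜ w) := fun h =>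
    not_isBounded_compl_closedBall R (h.subset
      ((isPreconnected_compl_closedBall R).subset_connectedComponentIn hw
        (compl_subset_compl.2 hR)))
  refine ⟨⟨hwS, hwb⟩, Subset.antisymm ?_ ?_⟩
  · rintro z ⟨hz, hzb⟩
    have := compl_closedBall_subset_connectedComponentIn hR hzb hw
    rw [← connectedComponentIn_eq this]
    exact mem_connectedComponentIn hz
  · intro z hz
    refine ⟨connectedComponentIn_subset _ _ hz, ?_⟩
    rwa [← connectedComponentIn_eq hz]

lemma exists_mem_outerFace (G : PlaneGraph E) (R : ℝ) :
    ∃ w ∈ G.outerFace, R < ‖w‖ := by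
  obtain ⟨R', h⟩ := G.exists_outerFace_eq
  obtain ⟨w, hw⟩ := NormedSpace.exists_lt_norm ℝ ℂ (max R R')
  obtain ⟨h1, h2⟩ := max_lt_iff.1 hw
  exact ⟨w, (h w (by simpa using h2)).1, h1⟩

lemma isFace_outerFace (G : PlaneGraph E) : IsFace G.support G.outerFace := by
  obtain ⟨R, h⟩ := G.exists_outerFace_eq
  obtain ⟨w, hw⟩ := NormedSpace.exists_lt_norm ℝ ℂ R
  rw [(h w (by simpa using hw)).2]
  exact isFace_connectedComponentIn G.isCompact_support.isClosed w

lemma outerFace_anti {G H : PlaneGraph E} (h : H.support ⊆ G.support) :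
    G.outerFace ⊆ H.outerFace := fun _ hz =>
  ⟨fun h' => hz.1 (h h'), fun hb => hz.2 (hb.subset
    (connectedComponentIn_mono _ (compl_subset_compl.2 h)))⟩

lemma mem_frontier_outerFace_iff {G : PlaneGraph E} {z : ℂ} (hz : z ∈ G.support) :
    z ∈ frontier G.outerFace ↔ z ∈ closure G.outerFace := by
  rw [G.isFace_outerFace.isOpen.frontier_eq]
  exact ⟨fun h => h.1, fun h => ⟨h, fun h' => G.isFace_outerFace.subset_compl h' hz⟩⟩

lemma mem_frontier_outerFace_mono {G H : PlaneGraph E} (h : H.support ⊆ G.support) {z : ℂ}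
    (hz : z ∈ H.support) (hzG : z ∈ frontier G.outerFace) : z ∈ frontier H.outerFace :=
  (mem_frontier_outerFace_iff hz).2 (closure_mono (outerFace_anti h) hzG.1)

lemma Inc.mem_range {G : PlaneGraph E} {e : E} {v : ℂ} (h : G.Inc e v) : v ∈ range (G.arc e) :=
  h.2.2.elim (fun h => ⟨0, h⟩) fun h => ⟨1, h⟩

lemma inc_of_mem_range {G : PlaneGraph E} {e : E} {v : ℂ} (he : e ∈ G.edges) (hv : v ∈ G.verts)
    (h : v ∈ range (G.arc e)) : G.Inc e v := by
  obtain ⟨t, rfl⟩ := h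
  refine ⟨he, hv, ?_⟩
  rcases G.eq_end_of_mem e he t hv with rfl | rfl
  exacts [Or.inl rfl, Or.inr rfl]

lemma exists_inc (G : PlaneGraph E) {e : E} (he : e ∈ G.edges) : ∃ v, G.Inc e v :=
  (G.end_mem e he).elim (fun h => ⟨_, he, h, Or.inl rfl⟩) fun h => ⟨_, he, h, Or.inr rfl⟩

/-- An edge incident to `v` has at most one end that is a vertex different from `v`. -/
lemma Inc.subsingleton {G : PlaneGraph E} {e : E} {v : ℂ} (h : G.Inc e v) :
    {x | x ∈ range (G.arc e) ∧ x ∈ G.verts ∧ x ≠ v}.Subsingleton := by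
  rintro x ⟨hx, hxV, hxv⟩ y ⟨hy, hyV, hyv⟩
  have h1 := (inc_of_mem_range h.1 hxV hx).2.2
  have h2 := (inc_of_mem_range h.1 hyV hy).2.2
  rcases h.2.2 with h0 | h0
  · rw [← h1.resolve_left fun h => hxv (h ▸ h0), ← h2.resolve_left fun h => hyv (h ▸ h0)]
  · rw [← h1.resolve_right fun h => hxv (h ▸ h0), ← h2.resolve_right fun h => hyv (h ▸ h0)]

lemma mem_verts_of_mem_range {G : PlaneGraph E} {e e' : E} (he : e ∈ G.edges) (he' : e' ∈ G.edges)
    (hne : e ≠ e') {x : ℂ} (hx : x ∈ range (G.arc e)) (hx' : x ∈ range (G.arc e')) :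
    x ∈ G.verts := by
  obtain ⟨s, rfl⟩ := hx
  obtain ⟨t, ht⟩ := hx'
  exact G.mem_of_meet e he e' he' hne s t ht.symm

lemma range_arc_subset_frontier {G : PlaneGraph E} {F : Set ℂ} (hF : IsFace G.support F) {e : E}
    (he : e ∈ G.edges) {x : ℂ} (hx : x ∈ range (G.arc e)) (hxV : x ∉ G.verts)
    (hxF : x ∈ frontier F) : range (G.arc e) ⊆ frontier F := by
  obtain ⟨s, rfl⟩ := hx
  have hR : ∀ t, G.arc e t ∈ G.verts ∪ ⋃ e' ∈ G.edges \ {e}, range (G.arc e') →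
      G.arc e t ∈ G.verts := by
    rintro t (h | h)
    · exact h
    · simp only [mem_iUnion] at h
      obtain ⟨e', he', h⟩ := h
      exact mem_verts_of_mem_range he he'.1 (fun h => he'.2 h.symm) ⟨t, rfl⟩ h
  refine IsFace.range_arc_subset_frontier
    (R := G.verts ∪ ⋃ e' ∈ G.edges \ {e}, range (G.arc e')) ?_
    (G.isCompact_verts_union subset_rfl sdiff_subset) (G.arc_injective e he)
    (fun u hu => G.eq_end_of_mem e he u (hR u hu)) (fun h => hxV (hR s h)) hxF
  convert hF using 1
  rw [union_assoc, union_comm _ (range _),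
    ← biUnion_insert e (G.edges \ {e}) fun e => range (G.arc e), insert_sdiff_singleton,
    insert_eq_of_mem he]
  rfl

/-- If not all edges at a vertex on the boundary of a face lie on that boundary, then at least two
of them do. -/
lemma exists_inc_pair_of_not_subset {G : PlaneGraph E} {F : Set ℂ} (hF : IsFace G.support F)
    {v : ℂ} (hvF : v ∈ frontier F) {e : E} (he : G.Inc e v)
    (heF : ¬ range (G.arc e) ⊆ frontier F) :
    ∃ e₁ e₂, e₁ ≠ e₂ ∧ (G.Inc e₁ v ∧ range (G.arc e₁) ⊆ frontier F) ∧
      (G.Inc e₂ v ∧ range (G.arc e₂) ⊆ frontier F) := by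
  by_contra! hcon
  -- Erase all edges off the boundary of `F`. By `hcon` at most one edge `e₁` remains at `v`; `A` is
  -- this edge, or `{v}` if there is none, and `R` is everything else.
  let B : Set E := {e | e ∈ G.edges ∧ range (G.arc e) ⊆ frontier F}
  let R : Set ℂ := (G.verts \ {v}) ∪ ⋃ e ∈ {e | e ∈ B ∧ ¬ G.Inc e v}, range (G.arc e)
  have hRc : IsCompact R := G.isCompact_verts_union sdiff_subset fun e he => he.1.1
  have hvV : v ∈ G.verts := he.2.1
  have hvR : v ∉ R := by
    rintro (h | h)
    · exact h.2 rfl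
    · simp only [mem_iUnion] at h
      obtain ⟨e', he', h⟩ := h
      exact he'.2 (inc_of_mem_range he'.1.1 hvV h)
  obtain ⟨A, hAc, hvA, hlog, hRA, hBA, hAS, heA⟩ : ∃ A, IsCompact A ∧ v ∈ A ∧
      (∀ a b, a ∉ A → b ∉ A → LogOn A a b) ∧ (R ∩ A).Subsingleton ∧
      (∀ e' ∈ B, G.Inc e' v → range (G.arc e') ⊆ A) ∧ A ⊆ G.support ∧
      ∀ x ∈ range (G.arc e), x ∈ A → x ∈ G.verts := by
    by_cases h1 : ∃ e₁ ∈ B, G.Inc e₁ v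
    · obtain ⟨e₁, he₁, hinc⟩ := h1
      have hall : ∀ e' ∈ B, G.Inc e' v → e' = e₁ := fun e' he' hinc' => by
        by_contra hne
        exact hcon e' e₁ hne ⟨hinc', he'.2⟩ hinc he₁.2
      have hr : range (G.arc e₁) = G.arc e₁ '' Icc 0 1 := by
        rw [← unitInterval.univ_eq_Icc, image_univ]
      refine ⟨_, G.isCompact_range_arc e₁, hinc.mem_range, ?_, ?_, ?_,
        range_arc_subset_support he₁.1, ?_⟩
      · rw [hr]
        exact fun a b => logOn_arc _ (G.arc_injective e₁ he₁.1) zero_le_one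
      · refine hinc.subsingleton.anti ?_
        rintro x ⟨hxR, hxA⟩
        refine ⟨hxA, ?_, fun h => hvR (h ▸ hxR)⟩
        rcases hxR with h | h
        · exact h.1
        · simp only [mem_iUnion] at h
          obtain ⟨e', he', h⟩ := h
          exact mem_verts_of_mem_range he'.1.1 he₁.1 (fun h => he'.2 (h ▸ hinc)) h hxA
      · intro e' he' hinc'
        rw [hall e' he' hinc']
      · intro x hx hx'
        exact mem_verts_of_mem_range he.1 he₁.1 (fun h => heF (h ▸ he₁.2)) hx hx'
    · push Not at h1
      refine ⟨{v}, isCompact_singleton, rfl, ?_, ?_, fun e' he' h => absurd h (h1 e' he'), ?_, ?_⟩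
      · exact fun a b ha hb => logOn_singleton ha hb
      · exact subsingleton_singleton.anti inter_subset_right
      · exact singleton_subset_iff.2 (G.verts_subset_support hvV)
      · rintro x - rfl
        exact hvV
  have hF' : IsFace (R ∪ A) F := by
    refine hF.mono (union_subset (union_subset ?_ ?_) hAS) fun x hx => ?_
    · exact sdiff_subset.trans G.verts_subset_support
    · exact iUnion₂_subset fun e' he' => range_arc_subset_support he'.1.1
    · by_cases hxV : x ∈ G.verts
      · by_cases hxv : x = v
        · exact Or.inr (hxv ▸ hvA)
        · exact Or.inl (Or.inl ⟨hxV, hxv⟩)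
      · rcases hF.frontier_subset hx with h | h
        · exact absurd h hxV
        · simp only [mem_iUnion] at h
          obtain ⟨e', he', h⟩ := h
          have he'B : e' ∈ B := ⟨he', range_arc_subset_frontier hF he' h hxV hx⟩
          by_cases hinc : G.Inc e' v
          · exact Or.inr (hBA e' he'B hinc h)
          · exact Or.inl (Or.inr (mem_biUnion (show e' ∈ {e | e ∈ B ∧ ¬ G.Inc e v} from
              ⟨he'B, hinc⟩) h))
  obtain ⟨U, hU, hvU, hUF⟩ := hF'.exists_isOpen_diff_subset hRc hAc hRA hlog
    isPreconnected_singleton (disjoint_singleton_left.2 hvR) ⟨v, rfl, frontier_subset_closure hvF⟩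
  obtain ⟨t, ht⟩ := he.mem_range
  -- Near `v`, `F` contains everything off `A`, in particular inner points of the edge `e`, which
  -- belong to the drawing.
  obtain ⟨u, hu, hu0, hu1⟩ := unitInterval.exists_mem_ne (x := t)
    ((hU.preimage (G.arc e).continuous).mem_nhds
      (show G.arc e t ∈ U from ht ▸ singleton_subset_iff.1 hvU))
  refine hF.subset_compl (hUF ⟨hu, fun h => ?_⟩) (range_arc_subset_support he.1 ⟨u, rfl⟩)
  exact (G.eq_end_of_mem e he.1 u (heA _ ⟨u, rfl⟩ h)).elim hu0 hu1

lemma outerVerts_nonempty {G : PlaneGraph E} (h : G.verts.Nonempty) : G.outerVerts.Nonempty := by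
  obtain ⟨v, hv⟩ := h
  have hF := G.isFace_outerFace
  have hne : frontier G.outerFace ≠ ∅ := fun h0 => by
    obtain ⟨w, hw, -⟩ := G.exists_mem_outerFace 0
    rcases isClopen_iff.1 (isClopen_iff_frontier_eq_empty.2 h0) with h | h
    · rw [h] at hw
      exact hw
    · exact hF.subset_compl (h ▸ mem_univ v) (G.verts_subset_support hv)
  obtain ⟨x, hx⟩ := nonempty_iff_ne_empty.2 hne
  by_cases hxV : x ∈ G.verts
  · exact ⟨x, hxV, hx⟩
  rcases hF.frontier_subset hx with h | h
  · exact absurd h hxV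
  simp only [mem_iUnion] at h
  obtain ⟨e, he, h⟩ := h
  obtain ⟨w, hw⟩ := G.exists_inc he
  exact ⟨w, hw.2.1, range_arc_subset_frontier hF he h hxV hx hw.mem_range⟩

/-- The vertices on the outer face stay there if isolated vertices and edges that have no further
neighbours at one of their ends are added. -/
lemma outerVerts_subset_of_pendant {H K : PlaneGraph E} (harc : K.arc = H.arc)
    (hV : H.verts ⊆ K.verts) (hE : H.edges ⊆ K.edges)
    (hpend : ∀ e ∈ K.edges \ H.edges, ∃ w, w ∉ H.verts ∧ K.Inc e w ∧ ∀ e', K.Inc e' w → e' = e) :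
    H.outerVerts ⊆ K.outerVerts := by
  have hlog : ∀ a b, a ∉ K.support → b ∉ K.support → LogOn H.support a b →
      LogOn K.support a b := by
    intro a b ha hb h
    have hne : ∀ c ∉ K.support, ∀ v ∈ K.verts, c ≠ v := fun c hc v hv h =>
      hc (h ▸ K.verts_subset_support hv)
    -- A new edge has no neighbour at its end `w`, so it meets the rest at most in its other end and
    -- the logarithms glue.
    have h1 : LogOn (H.support ∪ ⋃ e ∈ K.edges \ H.edges, range (K.arc e)) a b := by
      refine h.biUnion (K.finite_edges.subset sdiff_subset) H.isCompact_support.isClosed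
        (fun e _ => (K.isCompact_range_arc e).isClosed) (fun e he => ?_) fun e he => ?_
      · have hr : range (K.arc e) = K.arc e '' Icc 0 1 := by
          rw [← unitInterval.univ_eq_Icc, image_univ]
        rw [hr]
        refine logOn_arc _ (K.arc_injective e he.1) zero_le_one ?_ ?_ <;> rw [← hr]
        exacts [fun h => ha (range_arc_subset_support he.1 h),
          fun h => hb (range_arc_subset_support he.1 h)]
      · obtain ⟨w, hwH, hinc, hall⟩ := hpend e he
        refine hinc.subsingleton.anti ?_
        have key : ∀ x e', e' ∈ K.edges → e' ≠ e → x ∈ range (K.arc e') → x ∈ range (K.arc e) →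
            x ∈ K.verts ∧ x ≠ w := by
          intro x e' he' hne hx' hx
          have hxV := mem_verts_of_mem_range he' he.1 hne hx' hx
          refine ⟨hxV, ?_⟩
          rintro rfl
          exact hne (hall e' (inc_of_mem_range he' hxV hx'))
        rintro x ⟨(h | h) | h, hx⟩
        · exact ⟨hx, hV h, fun h' => hwH (h' ▸ h)⟩
        · simp only [mem_iUnion] at h
          obtain ⟨e', he', h⟩ := h
          exact ⟨hx, key x e' (hE he') (fun h => he.2 (h ▸ he')) (harc ▸ h) hx⟩
        · simp only [mem_iUnion] at h
          obtain ⟨e', he', h⟩ := h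
          exact ⟨hx, key x e' he'.1.1 he'.2 h hx⟩
    have h2 : LogOn ((H.support ∪ ⋃ e ∈ K.edges \ H.edges, range (K.arc e)) ∪
        ⋃ v ∈ K.verts, {v}) a b := by
      refine h1.biUnion K.finite_verts (H.isCompact_support.isClosed.union
        ((K.finite_edges.subset sdiff_subset).isClosed_biUnion
          fun e _ => (K.isCompact_range_arc e).isClosed)) (fun v _ => isClosed_singleton)
        (fun v hv => logOn_singleton (hne a ha v hv) (hne b hb v hv))
        fun v hv => subsingleton_singleton.anti inter_subset_right
    refine h2.mono ?_
    rintro x (hx | hx)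
    · exact Or.inr (mem_biUnion hx rfl)
    · simp only [mem_iUnion] at hx
      obtain ⟨e, he, hx⟩ := hx
      by_cases heH : e ∈ H.edges
      · exact Or.inl (Or.inl (range_arc_subset_support heH (harc ▸ hx)))
      · exact Or.inl (Or.inr (mem_biUnion (show e ∈ K.edges \ H.edges from ⟨he, heH⟩) hx))
  have hHK : H.support ⊆ K.support := by
    rintro x (hx | hx)
    · exact Or.inl (hV hx)
    · simp only [mem_iUnion] at hx
      obtain ⟨e, he, hx⟩ := hx
      exact range_arc_subset_support (hE he) (harc ▸ hx)
  have hface : H.outerFace ∩ K.supportᶜ ⊆ K.outerFace := by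
    rintro z ⟨hz, hzK⟩
    obtain ⟨w, hw, -⟩ := K.exists_mem_outerFace 0
    have hwK := K.isFace_outerFace.subset_compl hw
    have h := (hlog z w hzK hwK (logOn_of_isPreconnected H.isCompact_support.isClosed
      H.isFace_outerFace.isPreconnected H.isFace_outerFace.subset_compl hz
      (outerFace_anti hHK hw))).mem_connectedComponentIn K.isCompact_support hzK hwK
    exact K.isFace_outerFace.subset_of_isPreconnected isPreconnected_connectedComponentIn
      (connectedComponentIn_subset _ _) ⟨w, h, hw⟩ (_root_.mem_connectedComponentIn hzK)
  rintro v ⟨hv, hvF⟩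
  refine ⟨hV hv, (mem_frontier_outerFace_iff (K.verts_subset_support (hV hv))).2 ?_⟩
  -- The added pieces have empty interior, so removing them from the outer face of `H` does not
  -- change its closure.
  have hd : Dense K.supportᶜ := interior_eq_empty_iff_dense_compl.1 K.interior_support
  exact closure_mono hface (closure_minimal
    (hd.open_subset_closure_inter H.isFace_outerFace.isOpen) isClosed_closure hvF.1)

/-! ### Peeling -/

lemma exists_vertexPeeling (G : PlaneGraph E) : G.vertexPeelings.Nonempty := by
  induction hn : G.verts.ncard using Nat.strong_induction_on generalizing G with
  | _ n ih =>
    rcases G.verts.eq_empty_or_nonempty with h | h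
    · refine ⟨0, h, ?_⟩
      by_contra hne
      obtain ⟨e, he⟩ := nonempty_iff_ne_empty.2 hne
      obtain ⟨v, hv⟩ := G.exists_inc he
      simpa [h] using hv.2.1
    · obtain ⟨v, hv⟩ := outerVerts_nonempty h
      have hlt : G.peelVerts.verts.ncard < n := hn ▸
        ncard_lt_ncard ⟨sdiff_subset, fun h => (h hv.1).2 hv⟩ G.finite_verts
      obtain ⟨k, hk⟩ := ih _ hlt G.peelVerts rfl
      exact ⟨k + 1, hk⟩

lemma peelVerts_iterate (G : PlaneGraph E) (k : ℕ) :
    (peelVerts^[k] G).arc = G.arc ∧ (peelVerts^[k] G).verts ⊆ G.verts ∧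
      ∀ e, e ∈ (peelVerts^[k] G).edges ↔
        e ∈ G.edges ∧ ∀ v, G.Inc e v → v ∈ (peelVerts^[k] G).verts := by
  induction k with
  | zero => exact ⟨rfl, subset_rfl, fun e => ⟨fun h => ⟨h, fun v hv => hv.2.1⟩, fun h => h.1⟩⟩
  | succ k ih =>
    rw [Function.iterate_succ_apply']
    set H := peelVerts^[k] G
    obtain ⟨h1, h2, h3⟩ := ih
    refine ⟨h1, sdiff_subset.trans h2, fun e => ⟨fun h => ?_, fun h => ?_⟩⟩
    · obtain ⟨heG, hv⟩ := (h3 e).1 h.1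
      refine ⟨heG, fun v hinc => ⟨hv v hinc, fun hS => h.2 v hS ⟨h.1, hv v hinc, ?_⟩⟩⟩
      rw [h1]
      exact hinc.2.2
    · have heH : e ∈ H.edges := (h3 e).2 ⟨h.1, fun v hv => (h.2 v hv).1⟩
      refine ⟨heH, fun v hS hinc => (h.2 v ⟨h.1, h2 hinc.2.1, ?_⟩).2 hS⟩
      rw [← h1]
      exact hinc.2.2

lemma peelEdges_iterate (G : PlaneGraph E) (k : ℕ) :
    (peelEdges^[k] G).arc = G.arc ∧ (peelEdges^[k] G).verts = G.verts ∧
      (peelEdges^[k] G).edges ⊆ G.edges := by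
  induction k with
  | zero => exact ⟨rfl, rfl, subset_rfl⟩
  | succ k ih =>
    rw [Function.iterate_succ_apply']
    exact ⟨ih.1, ih.2.1, sdiff_subset.trans ih.2.2⟩

lemma edges_peelVerts_iterate_subset {G : PlaneGraph E} {k : ℕ}
    (h : ∀ v ∈ (peelVerts^[k] G).verts, ∀ e, G.Inc e v → e ∈ (peelEdges^[k] G).edges) :
    (peelVerts^[k] G).edges ⊆ (peelEdges^[k] G).edges := by
  intro e he
  obtain ⟨heG, hv⟩ := ((G.peelVerts_iterate k).2.2 e).1 he
  obtain ⟨v, hinc⟩ := G.exists_inc heG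
  exact h v (hv v hinc) e hinc

lemma support_peelVerts_iterate_subset {G : PlaneGraph E} {k : ℕ}
    (h : (peelVerts^[k] G).edges ⊆ (peelEdges^[k] G).edges) :
    (peelVerts^[k] G).support ⊆ (peelEdges^[k] G).support := by
  refine union_subset_union ?_ ?_
  · rw [(G.peelEdges_iterate k).2.1]
    exact (G.peelVerts_iterate k).2.1
  · rw [(G.peelEdges_iterate k).1, (G.peelVerts_iterate k).1]
    exact biUnion_subset_biUnion_left h

/-- Edge peeling does not reach the edges at a vertex before vertex peeling reaches the vertex. -/
lemma mem_edges_peelEdges_iterate (G : PlaneGraph E) (k : ℕ) :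
    ∀ v ∈ (peelVerts^[k] G).verts, ∀ e, G.Inc e v → e ∈ (peelEdges^[k] G).edges := by
  induction k with
  | zero => exact fun v _ e he => he.1
  | succ k ih =>
    have hsupp := support_peelVerts_iterate_subset (edges_peelVerts_iterate_subset ih)
    have harc := (G.peelEdges_iterate k).1
    rw [Function.iterate_succ_apply', Function.iterate_succ_apply']
    rintro v ⟨hv, hvo⟩ e he
    refine ⟨ih v hv e he, fun hout => hvo ⟨hv, ?_⟩⟩
    refine mem_frontier_outerFace_mono hsupp (verts_subset_support _ hv) (hout.2 ?_)
    rw [harc]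
    exact he.mem_range

/-- Two surviving edges at `v`, together with the two boundary edges that any survivor forces, would
make four. -/
lemma subsingleton_inc_peelEdges {G : PlaneGraph E} {v : ℂ} (hv : v ∈ frontier G.outerFace)
    (hdeg : G.degree v ≤ 3) : {e | G.peelEdges.Inc e v}.Subsingleton := by
  intro e he e' he'
  by_contra hne
  have hinc : ∀ e, G.peelEdges.Inc e v → G.Inc e v := fun e h => ⟨h.1.1, h.2⟩
  have hout : ∀ e, G.peelEdges.Inc e v → ¬ range (G.arc e) ⊆ frontier G.outerFace :=
    fun e h h' => h.1.2 ⟨h.1.1, h'⟩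
  obtain ⟨e₁, e₂, h12, h1, h2⟩ :=
    exists_inc_pair_of_not_subset G.isFace_outerFace hv (hinc e he) (hout e he)
  have hsub : ({e, e', e₁, e₂} : Set E) ⊆ {e | G.Inc e v} := by
    rintro x (rfl | rfl | rfl | rfl)
    exacts [hinc _ he, hinc _ he', h1.1, h2.1]
  have hcard : ({e, e', e₁, e₂} : Set E).ncard = 4 := by
    have n1 : ∀ x, range (G.arc x) ⊆ frontier G.outerFace → e ≠ x := fun x hx h =>
      hout e he (h ▸ hx)
    have n2 : ∀ x, range (G.arc x) ⊆ frontier G.outerFace → e' ≠ x := fun x hx h =>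
      hout e' he' (h ▸ hx)
    rw [ncard_insert_of_notMem (by simp [hne, n1 _ h1.2, n1 _ h2.2]),
      ncard_insert_of_notMem (by simp [n2 _ h1.2, n2 _ h2.2]), ncard_pair h12]
  have := ncard_le_ncard hsub (G.finite_edges.subset fun e h => h.1)
  rw [hcard] at this
  exact absurd (this.trans hdeg) (by norm_num)

/-- When vertex peeling has removed a vertex of a subcubic graph, edge peeling has made it an end
vertex (or an isolated vertex) on the outer face. -/
lemma mem_frontier_and_subsingleton_inc (G : PlaneGraph E) (hG : ∀ v ∈ G.verts, G.degree v ≤ 3)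
    (k : ℕ) : ∀ v ∈ G.verts, v ∉ (peelVerts^[k] G).verts →
      v ∈ frontier (peelEdges^[k] G).outerFace ∧
        {e | (peelEdges^[k] G).Inc e v}.Subsingleton := by
  induction k with
  | zero => exact fun v hv hv' => absurd hv hv'
  | succ k ih =>
    intro v hv hvk
    have hVE := edges_peelVerts_iterate_subset (G.mem_edges_peelEdges_iterate k)
    obtain ⟨harcV, hVV, hEV⟩ := G.peelVerts_iterate k
    obtain ⟨harcE, hVE', hEE⟩ := G.peelEdges_iterate k
    rw [Function.iterate_succ_apply'] at hvk ⊢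
    have hinc : ∀ e w, (peelEdges^[k] G).Inc e w ↔ e ∈ (peelEdges^[k] G).edges ∧ G.Inc e w := by
      intro e w
      rw [Inc, Inc, harcE, hVE']
      exact ⟨fun h => ⟨h.1, hEE h.1, h.2⟩, fun h => ⟨h.1, h.2.2⟩⟩
    have hvsupp : v ∈ (peelEdges^[k] G).peelEdges.support := Or.inl (by
      change v ∈ (peelEdges^[k] G).verts
      rwa [hVE'])
    have hmono : (peelEdges^[k] G).peelEdges.support ⊆ (peelEdges^[k] G).support :=
      union_subset_union_right _ (biUnion_subset_biUnion_left sdiff_subset)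
    have hvF : v ∈ frontier (peelEdges^[k] G).outerFace := by
      by_cases hvV : v ∈ (peelVerts^[k] G).verts
      · have hout : v ∈ (peelVerts^[k] G).outerVerts := by
          by_contra h
          exact hvk ⟨hvV, h⟩
        refine (outerVerts_subset_of_pendant (harcE.trans harcV.symm) (hVE' ▸ hVV) hVE ?_ hout).2
        -- An edge left only by edge peeling has an end `w` already removed by vertex peeling; by
        -- induction `e` is the only edge still at `w`.
        rintro e ⟨heE, heV⟩
        rw [hEV] at heV
        push Not at heV
        obtain ⟨w, hw, hwV⟩ := heV (hEE heE)
        have hew := (hinc e w).2 ⟨heE, hw⟩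
        exact ⟨w, hwV, hew, fun e' he' => (ih w hw.2.1 hwV).2 he' hew⟩
      · exact (ih v hv hvV).1
    refine ⟨mem_frontier_outerFace_mono hmono hvsupp hvF, subsingleton_inc_peelEdges hvF ?_⟩
    exact (ncard_le_ncard (fun e he => ((hinc e v).1 he).2)
      (G.finite_edges.subset fun e h => h.1)).trans (hG v hv)

lemma mem_vertexPeelings_of_mem_edgePeelings {G : PlaneGraph E}
    (hG : ∀ v ∈ G.verts, G.degree v ≠ 0) {k : ℕ} (hk : k ∈ G.edgePeelings) :
    k ∈ G.vertexPeelings := by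
  have hverts : (peelVerts^[k] G).verts = ∅ := by
    by_contra hne
    obtain ⟨v, hv⟩ := nonempty_iff_ne_empty.2 hne
    obtain ⟨e, he⟩ := nonempty_of_ncard_ne_zero (hG v ((G.peelVerts_iterate k).2.1 hv))
    have := G.mem_edges_peelEdges_iterate k v hv e he
    rw [show (peelEdges^[k] G).edges = ∅ from hk] at this
    exact this
  refine ⟨hverts, subset_empty_iff.1 ?_⟩
  exact (edges_peelVerts_iterate_subset (G.mem_edges_peelEdges_iterate k)).trans hk.subset

lemma succ_mem_edgePeelings_of_mem_vertexPeelings {G : PlaneGraph E}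
    (hG : ∀ v ∈ G.verts, G.degree v ≤ 3) {k : ℕ} (hk : k ∈ G.vertexPeelings) :
    k + 1 ∈ G.edgePeelings := by
  change (peelEdges^[k + 1] G).edges = ∅
  rw [Function.iterate_succ_apply']
  refine eq_empty_of_forall_notMem ?_
  rintro e ⟨he, hout⟩
  obtain ⟨v, hv⟩ := (peelEdges^[k] G).exists_inc he
  obtain ⟨hvF, hsub⟩ := G.mem_frontier_and_subsingleton_inc hG k v
    ((G.peelEdges_iterate k).2.1 ▸ hv.2.1) (by rw [hk.1]; exact notMem_empty v)
  -- An edge surviving the extra round would force two boundary edges at `v`, where at most one edge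
  -- is left.
  obtain ⟨e₁, e₂, h12, h1, h2⟩ := exists_inc_pair_of_not_subset
    (peelEdges^[k] G).isFace_outerFace hvF hv fun h => hout ⟨he, h⟩
  exact h12 (hsub h1.1 h2.1)

end PlaneGraph

/-- The first two conjuncts say that both peeling processes end, so that the two numbers are the
genuine minima. -/
theorem proposition1 {E : Type*} (G : PlaneGraph E) (hG : G.IsRegular 3) :
    IsLeast G.vertexPeelings G.vertexOuterplanarity ∧
    IsLeast G.edgePeelings G.edgeOuterplanarity ∧
    G.vertexOuterplanarity ≤ G.edgeOuterplanarity ∧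
    G.edgeOuterplanarity ≤ 1 + G.vertexOuterplanarity := by
  have hle : ∀ v ∈ G.verts, G.degree v ≤ 3 := fun v hv => (hG v hv).le
  have hne : ∀ v ∈ G.verts, G.degree v ≠ 0 := fun v hv => by
    rw [hG v hv]
    norm_num
  have hV : G.vertexOuterplanarity ∈ G.vertexPeelings := Nat.sInf_mem G.exists_vertexPeeling
  have hE' := PlaneGraph.succ_mem_edgePeelings_of_mem_vertexPeelings hle hV
  have hE : G.edgeOuterplanarity ∈ G.edgePeelings := Nat.sInf_mem ⟨_, hE'⟩
  refine ⟨⟨hV, fun k hk => Nat.sInf_le hk⟩, ⟨hE, fun k hk => Nat.sInf_le hk⟩, ?_, ?_⟩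
  · exact Nat.sInf_le (PlaneGraph.mem_vertexPeelings_of_mem_edgePeelings hne hE)
  · rw [add_comm]
    exact Nat.sInf_le hE'
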